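/- Let $a<b$ be real numbers and let $f:[a,b]\to\mathbb{R}$ be regulated, i.e. $f$ has finite right limits at every point of $[a,b)$ and finite left limits at every point of $(a,b]$. Let $c>0$. For $y\in\mathbb{R}$ put $\tilde\sigma_0=a$, $\tilde\tau_0=\inf\{t\in[a,b]: f(t)<y\}$ and, for $n\ge 0$, $$\tilde\sigma_{n+1}=\inf\{t>\tilde\tau_n: t\le b,\ f(t)>y+c\},\qquad \tilde\tau_{n+1}=\inf\{t>\tilde\sigma_{n+1}: t\le b,\ f(t)<y\},$$ with $\inf\emptyset=+\infty$. The number of upcrossings by $f$ of the segment $[y,y+c]$ is $u_c^y(f)=\max\{n\ge 0:\tilde\sigma_n\le b\}$. The number $d_c^y(f)$ of downcrossings of $[y,y+c]$ is defined in the same way with the conditions $f(t)<y$ and $f(t)>y+c$ interchanged, and $n_c^y(f)=d_c^y(f)+u_c^y(f)$. Let $TV(g)$ denote the total variation of a function $g$ on $[a,b]$, and put $$UTV^c(f)=\sup\sum_{i=1}^n\max\{f(t_i)-f(t_{i-1})-c,0\},\qquad DTV^c(f)=\sup\sum_{i=1}^n\max\{f(t_{i-1})-f(t_i)-c,0\},$$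 $$TV^c(f)=\sup\sum_{i=1}^n\max\{|f(t_i)-f(t_{i-1})|-c,0\},$$ where the suprema are over all $n$ and all $a\le t_0<t_1<\dots<t_n\le b$. Then $u_c^y(f)$ and $d_c^y(f)$ are finite for every $y\in\mathbb{R}$, the functions $y\mapsto u_c^y(f)$ and $y\mapsto d_c^y(f)$ are pointwise limits of sequences of step functions on $\mathbb{R}$ (functions which, off some finite set of points, are constant on each of the finitely many complementary open intervals), $TV^c(f)<\infty$, and $$UTV^c(f)=\int_{\mathbb{R}}u_c^y(f)\,dy,\qquad DTV^c(f)=\int_{\mathbb{R}}d_c^y(f)\,dy,$$ $$TV^c(f)=\int_{\mathbb{R}}n_c^y(f)\,dy=\inf\Big\{TV(g)\ :\ g:[a,b]\to\mathbb{R},\ \sup_{t\in[a,b]}|f(t)-g(t)|\le c/2\Big\}.$$ -/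

import Mathlib

open Filter Topology MeasureTheory Set
open scoped ENNReal

/-- `f` is regulated on `[a, b]`: it has a finite right limit at every point of `[a, b)` and a
finite left limit at every point of `(a, b]`. -/
def IsRegulatedOn (f : ℝ → ℝ) (a b : ℝ) : Prop :=
  (∀ t ∈ Ico a b, ∃ l : ℝ, Tendsto f (𝓝[>] t) (𝓝 l)) ∧
  (∀ t ∈ Ioc a b, ∃ l : ℝ, Tendsto f (𝓝[<] t) (𝓝 l))

/-- A step function on `ℝ`: there are finitely many points such that the function is constant on
every interval that contains none of them (its values at these points are arbitrary). -/
def IsStepFunction (φ : ℝ → ℝ) : Prop :=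
  ∃ S : Finset ℝ, ∀ x y : ℝ, x ≤ y → (∀ s ∈ S, s ∉ Icc x y) → φ x = φ y

/-- `F` is the limit, at every point of `ℝ`, of a sequence of step functions. -/
def IsPointwiseLimitOfStepFunctions (F : ℝ → ℝ) : Prop :=
  ∃ φ : ℕ → ℝ → ℝ, (∀ k, IsStepFunction (φ k)) ∧
    ∀ y : ℝ, Tendsto (fun k => φ k y) atTop (𝓝 (F y))

/-- The infimum in the extended reals of the times `t ∈ [a, b]` with `P t`; it is `⊤ = +∞` if
there is no such time. -/
noncomputable def firstTime (a b : ℝ) (P : ℝ → Prop) : EReal :=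
  sInf {s : EReal | ∃ t : ℝ, t ∈ Icc a b ∧ P t ∧ s = (t : EReal)}

/-- The times `σ₀, σ₁, …`: `σ₀ = a` and, for `n = 0, 1, …`,
`τₙ = inf {t > σₙ : t ≤ b, P t}` (where for `n = 0` also `t = σ₀ = a` is allowed) and
`σₙ₊₁ = inf {t > τₙ : t ≤ b, Q t}`. -/
noncomputable def cycleTime (a b : ℝ) (P Q : ℝ → Prop) : ℕ → EReal
  | 0 => (a : EReal)
  | n + 1 =>
    firstTime a b fun t =>
      firstTime a b (fun s => (n = 0 ∨ cycleTime a b P Q n < (s : EReal)) ∧ P s) < (t : EReal) ∧ Q t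

/-- The largest `n` with `σₙ ≤ b` (`⊤` if there are arbitrarily large such `n`). -/
noncomputable def cycleCount (a b : ℝ) (P Q : ℝ → Prop) : ℕ∞ :=
  ⨆ (n : ℕ) (_ : cycleTime a b P Q n ≤ (b : EReal)), (n : ℕ∞)

/-- The number of upcrossings by `f` of the segment `[y, y + c]` on `[a, b]`. -/
noncomputable def segmentUpcrossings (f : ℝ → ℝ) (a b c y : ℝ) : ℕ∞ :=
  cycleCount a b (fun t => f t < y) (fun t => y + c < f t)

/-- The number of downcrossings by `f` of the segment `[y, y + c]` on `[a, b]`. -/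
noncomputable def segmentDowncrossings (f : ℝ → ℝ) (a b c y : ℝ) : ℕ∞ :=
  cycleCount a b (fun t => y + c < f t) (fun t => f t < y)

/-- The number of crossings by `f` of the segment `[y, y + c]` on `[a, b]`. -/
noncomputable def segmentCrossings (f : ℝ → ℝ) (a b c y : ℝ) : ℕ∞ :=
  segmentDowncrossings f a b c y + segmentUpcrossings f a b c y

/-- The supremum over `n` and over `a ≤ t₀ < t₁ < ⋯ < tₙ ≤ b` of `∑ w (tᵢ₋₁) (tᵢ)`. -/
noncomputable def partitionSup (a b : ℝ) (w : ℝ → ℝ → ℝ) : ℝ≥0∞ :=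
  ⨆ (n : ℕ) (t : ℕ → ℝ) (_ : StrictMonoOn t (Iic n)) (_ : ∀ i ≤ n, t i ∈ Icc a b),
    ENNReal.ofReal (∑ i ∈ Finset.range n, w (t i) (t (i + 1)))

/-- The truncated variation of `f` on `[a, b]` with truncation parameter `c`. -/
noncomputable def truncVar (f : ℝ → ℝ) (a b c : ℝ) : ℝ≥0∞ :=
  partitionSup a b fun s t => max (|f t - f s| - c) 0

/-- The upward truncated variation of `f` on `[a, b]` with truncation parameter `c`. -/
noncomputable def upTruncVar (f : ℝ → ℝ) (a b c : ℝ) : ℝ≥0∞ :=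
  partitionSup a b fun s t => max (f t - f s - c) 0

/-- The downward truncated variation of `f` on `[a, b]` with truncation parameter `c`. -/
noncomputable def downTruncVar (f : ℝ → ℝ) (a b c : ℝ) : ℝ≥0∞ :=
  partitionSup a b fun s t => max (f s - f t - c) 0

/-!
The proof compares the four quantities in a circle.

For arbitrary `f`, the greedy count of crossings is the largest length of an alternating chain
`s₁ < t₁ < s₂ < t₂ < ⋯` with `f (sᵢ) < y` and `y + c < f (tᵢ)`
(`cycleCount_eq_alternationCount`). Downcrossings are upcrossings of `-f`, so only upcrossings are
treated. Write `u`, `d` for the counts and `UTV`, `DTV`, `TV` for the truncated variations.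

* `UTV ≤ ∫ u`: for a fixed partition `max (f tᵢ₊₁ - f tᵢ - c) 0` is the length of the set of levels
  `y` for which the step from `tᵢ` to `tᵢ₊₁` jumps over `[y, y + c]`, and these steps form a chain
  (`upTruncVar_le_lintegral_upCount`). Likewise `DTV ≤ ∫ d`, and `TV ≤ UTV + DTV` is clear.
* `∫ u + ∫ d ≤ TV(g)` whenever `|f - g| ≤ c / 2`: every crossing of `[y, y + c]` by `f` makes `g`
  pass the level `y + c / 2`, and along finitely many times the integral over `y` of the number of
  passages is the variation of `g` (`lintegral_upCount_add_le_eVariationOn`). The passage to all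
  times is monotone convergence along an increasing sequence of finite sets of times. It exists
  because the graph of `f` is separable and the crossing conditions are strict
  (`exists_finset_exhaustion`); it also exhibits `u` and `d` as limits of step functions.
* Some `g` with `|f - g| ≤ c / 2` has `TV(g) ≤ TV` (`exists_approximant`). Along finitely many times
  this is a dynamic programme: the least cost of an approximant with last value `z` is
  `m + dist (z, [α, β])`, and partitions certify that `m ≤ TV` (`IsOptimalState`). Compactness
  of a product of intervals gives an approximant on all of `[a, b]`.

Thus `TV ≤ UTV + DTV ≤ ∫ u + ∫ d ≤ TV(g) ≤ TV`. That `f` is regulated enters only through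
`TV < ∞` (`IsRegulatedOn.truncVar_ne_top`), which forces equality in each of the two summands. Finiteness of
`u` at every level follows from `∫ u < ∞` for the parameter `c / 2`
(`upCount_ne_top_of_lintegral_ne_top`).
-/

/-! ### Alternating chains and the greedy count -/

/-- There are times `s₁ < t₁ < s₂ < t₂ < ⋯ < sₙ < tₙ < x` in `A` with `P (sᵢ)` and `Q (tᵢ)` for
all `i`. The recursion peels off the last pair. -/
def AlternatesBefore (A : Set ℝ) (P Q : ℝ → Prop) : ℕ → ℝ → Prop
  | 0, _ => True
  | n + 1, x => ∃ s ∈ A, ∃ t ∈ A, s < t ∧ t < x ∧ P s ∧ Q t ∧ AlternatesBefore A P Q n s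

/-- The largest length of an alternating chain in `A`. -/
noncomputable def alternationCount (A : Set ℝ) (P Q : ℝ → Prop) : ℕ∞ :=
  ⨆ (n : ℕ) (_ : ∃ x, AlternatesBefore A P Q n x), (n : ℕ∞)

section Alternation

variable {A B : Set ℝ} {P Q P' Q' : ℝ → Prop} {m n : ℕ} {x x' : ℝ}

lemma AlternatesBefore.mono_right (h : AlternatesBefore A P Q n x) (hx : x ≤ x') :
    AlternatesBefore A P Q n x' := by
  cases n with
  | zero => trivial
  | succ n =>
    obtain ⟨s, hs, t, ht, hst, htx, h⟩ := h
    exact ⟨s, hs, t, ht, hst, htx.trans_le hx, h⟩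

lemma AlternatesBefore.of_le (h : AlternatesBefore A P Q n x) (hm : m ≤ n) :
    AlternatesBefore A P Q m x := by
  induction n with
  | zero => obtain rfl : m = 0 := by omega
            trivial
  | succ n ih =>
    rcases hm.eq_or_lt with rfl | hm
    · exact h
    · obtain ⟨s, hs, t, ht, hst, htx, -, -, h⟩ := h
      exact ih (h.mono_right (hst.trans htx).le) (by omega)

lemma AlternatesBefore.mono (hAB : A ⊆ B) (hP : ∀ s ∈ A, P s → P' s) (hQ : ∀ s ∈ A, Q s → Q' s)
    (h : AlternatesBefore A P Q n x) : AlternatesBefore B P' Q' n x := by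
  induction n generalizing x with
  | zero => trivial
  | succ n ih =>
    obtain ⟨s, hs, t, ht, hst, htx, hPs, hQt, h⟩ := h
    exact ⟨s, hAB hs, t, hAB ht, hst, htx, hP s hs hPs, hQ t ht hQt, ih h⟩

lemma natCast_le_alternationCount :
    (n : ℕ∞) ≤ alternationCount A P Q ↔ ∃ x, AlternatesBefore A P Q n x := by
  refine ⟨fun h => ?_, fun h => le_iSup₂_of_le n h le_rfl⟩
  by_contra hn
  obtain _ | n := n
  · exact hn ⟨0, trivial⟩
  · have : alternationCount A P Q ≤ n := by
      refine iSup₂_le fun m ⟨x, hx⟩ => ?_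
      by_contra hm
      have hm : n + 1 ≤ m := by
        rw [not_le] at hm
        exact_mod_cast hm
      exact hn ⟨x, hx.of_le hm⟩
    have := h.trans this
    norm_cast at this
    omega

lemma alternationCount_mono (hAB : A ⊆ B) (hP : ∀ s ∈ A, P s → P' s)
    (hQ : ∀ s ∈ A, Q s → Q' s) : alternationCount A P Q ≤ alternationCount B P' Q' :=
  iSup_mono fun _ => iSup_le fun ⟨x, hx⟩ => le_iSup_of_le ⟨x, hx.mono hAB hP hQ⟩ le_rfl

lemma firstTime_lt_coe {a b : ℝ} : firstTime a b P < (x : EReal) ↔ ∃ t ∈ Icc a b, P t ∧ t < x := by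
  unfold firstTime
  rw [sInf_lt_iff]
  constructor
  · rintro ⟨_, ⟨t, ht, hP, rfl⟩, h⟩
    exact ⟨t, ht, hP, by exact_mod_cast h⟩
  · rintro ⟨t, ht, hP, h⟩
    exact ⟨t, ⟨t, ht, hP, rfl⟩, by exact_mod_cast h⟩

lemma firstTime_le_right {a b : ℝ} : firstTime a b P ≤ (b : EReal) ↔ ∃ t ∈ Icc a b, P t := by
  constructor
  · intro h
    have : firstTime a b P < ((b + 1 : ℝ) : EReal) :=
      h.trans_lt (by exact_mod_cast lt_add_one b)
    obtain ⟨t, ht, hP, -⟩ := firstTime_lt_coe.1 this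
    exact ⟨t, ht, hP⟩
  · rintro ⟨t, ht, hP⟩
    have h : firstTime a b P ≤ (t : EReal) := sInf_le ⟨t, ht, hP, rfl⟩
    exact h.trans (by exact_mod_cast ht.2)

/-- The greedy times are the earliest possible ends of alternating chains. -/
lemma cycleTime_succ_lt_coe {a b : ℝ} :
    cycleTime a b P Q (n + 1) < (x : EReal) ↔ AlternatesBefore (Icc a b) P Q (n + 1) x := by
  induction n generalizing x with
  | zero =>
    simp only [cycleTime, firstTime_lt_coe, AlternatesBefore]
    grind
  | succ n ih =>
    rw [cycleTime, firstTime_lt_coe]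
    simp only [firstTime_lt_coe, ih]
    rw [AlternatesBefore]
    grind

lemma cycleCount_eq_alternationCount {a b : ℝ} (hab : a ≤ b) :
    cycleCount a b P Q = alternationCount (Icc a b) P Q := by
  have key (n : ℕ) : cycleTime a b P Q n ≤ (b : EReal) ↔
      ∃ x, AlternatesBefore (Icc a b) P Q n x := by
    cases n with
    | zero =>
      refine ⟨fun _ => ⟨0, trivial⟩, fun _ => ?_⟩
      rw [cycleTime]
      exact_mod_cast hab
    | succ n =>
      constructor
      · intro h
        exact ⟨b + 1, cycleTime_succ_lt_coe.1 (h.trans_lt (by exact_mod_cast lt_add_one b))⟩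
      · rintro ⟨x, hx⟩
        have h := cycleTime_succ_lt_coe.2 hx
        rw [cycleTime] at h ⊢
        obtain ⟨t, ht, hR, -⟩ := firstTime_lt_coe.1 h
        exact firstTime_le_right.2 ⟨t, ht, hR⟩
  unfold cycleCount alternationCount
  simp only [key]

end Alternation

/-- The largest number of upcrossings of `[y, y + c]` by `f` along times taken from `A`. -/
noncomputable def upCount (A : Set ℝ) (f : ℝ → ℝ) (c y : ℝ) : ℕ∞ :=
  alternationCount A (fun t => f t < y) (fun t => y + c < f t)

lemma segmentUpcrossings_eq_upCount {a b : ℝ} (hab : a ≤ b) (f : ℝ → ℝ) (c y : ℝ) :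
    segmentUpcrossings f a b c y = upCount (Icc a b) f c y :=
  cycleCount_eq_alternationCount hab

/-- Downcrossings of `[y, y + c]` by `f` are upcrossings of `[-y - c, -y]` by `-f`. -/
lemma segmentDowncrossings_eq_upCount_neg {a b : ℝ} (hab : a ≤ b) (f : ℝ → ℝ) (c y : ℝ) :
    segmentDowncrossings f a b c y = upCount (Icc a b) (fun t => -f t) c (-y - c) := by
  have hP (t : ℝ) : y + c < f t ↔ -f t < -y - c := by constructor <;> intro h <;> linarith
  have hQ (t : ℝ) : f t < y ↔ -y - c + c < -f t := by constructor <;> intro h <;> linarith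
  simp only [segmentDowncrossings, upCount, cycleCount_eq_alternationCount hab, hP, hQ]

lemma upCount_mono {A B : Set ℝ} (hAB : A ⊆ B) (f : ℝ → ℝ) (c y : ℝ) :
    upCount A f c y ≤ upCount B f c y :=
  alternationCount_mono hAB (fun _ _ h => h) (fun _ _ h => h)

/-! ### Dependence of the crossing count on the level -/

lemma isOpen_setOf_upAlternates (A : Set ℝ) (f : ℝ → ℝ) (c : ℝ) (n : ℕ) (x : ℝ) :
    IsOpen {y | AlternatesBefore A (fun t => f t < y) (fun t => y + c < f t) n x} := by
  induction n generalizing x with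
  | zero => simp [AlternatesBefore]
  | succ n ih =>
    have : {y | AlternatesBefore A (fun t => f t < y) (fun t => y + c < f t) (n + 1) x} =
        ⋃ s ∈ A, ⋃ t ∈ A, ⋃ (_ : s < t), ⋃ (_ : t < x), {y | f s < y} ∩ ({y | y + c < f t} ∩
          {y | AlternatesBefore A (fun t => f t < y) (fun t => y + c < f t) n s}) := by
      ext y
      simp only [AlternatesBefore, mem_ofPred_eq, mem_iUnion, mem_inter_iff, exists_prop]
    rw [this]
    exact isOpen_biUnion fun s _ => isOpen_biUnion fun t _ => isOpen_iUnion fun _ =>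
      isOpen_iUnion fun _ => (isOpen_lt continuous_const continuous_id).inter
        ((isOpen_lt (by fun_prop) continuous_const).inter (ih s))

/-- The crossing count is measurable in the level because its superlevel sets are open. -/
lemma measurable_upCount (A : Set ℝ) (f : ℝ → ℝ) (c : ℝ) :
    Measurable fun y => (upCount A f c y : ℝ≥0∞) := by
  have hE (n : ℕ) : MeasurableSet {y | (n : ℕ∞) ≤ upCount A f c y} := by
    have : {y | (n : ℕ∞) ≤ upCount A f c y} =
        ⋃ x, {y | AlternatesBefore A (fun t => f t < y) (fun t => y + c < f t) n x} := by
      ext y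
      simp [upCount, natCast_le_alternationCount]
    rw [this]
    exact (isOpen_iUnion fun x => isOpen_setOf_upAlternates A f c n x).measurableSet
  have : (fun y => (upCount A f c y : ℝ≥0∞)) =
      fun y => ⨆ n : ℕ, indicator {y | (n : ℕ∞) ≤ upCount A f c y} (fun _ => (n : ℝ≥0∞)) y := by
    funext y
    apply le_antisymm
    · have h := (ENat.toENNReal_iSup fun n : ℕ =>
        ⨆ _ : ∃ x, AlternatesBefore A (fun t => f t < y) (fun t => y + c < f t) n x, (n : ℕ∞))
      rw [upCount, alternationCount, h]
      refine iSup_le fun n => ?_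
      rw [ENat.toENNReal_iSup]
      refine iSup_le fun hn => le_iSup_of_le n ?_
      rw [indicator_of_mem]
      · simp
      · exact natCast_le_alternationCount.2 hn
    · refine iSup_le fun n => ?_
      rw [indicator_apply]
      split_ifs with hy
      · have hy : (n : ℕ∞) ≤ upCount A f c y := hy
        exact_mod_cast ENat.toENNReal_le.2 hy
      · exact zero_le
  rw [this]
  exact Measurable.iSup fun n => measurable_const.indicator (hE n)

/-- For finitely many times the count depends only on which of the values `f t`, `f t - c` lie
below the level. -/
lemma isStepFunction_upCount_finset (T : Finset ℝ) (f : ℝ → ℝ) (c : ℝ) :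
    IsStepFunction fun y => ((upCount T f c y).toNat : ℝ) := by
  classical
  refine ⟨T.image f ∪ T.image (fun t => f t - c), fun x y hxy h => ?_⟩
  have h1 : ∀ t ∈ T, (f t < x ↔ f t < y) := fun t ht => by
    have := h (f t) (Finset.mem_union_left _ (Finset.mem_image_of_mem f ht))
    rw [mem_Icc, not_and_or] at this
    grind
  have h2 : ∀ t ∈ T, (x + c < f t ↔ y + c < f t) := fun t ht => by
    have := h (f t - c)
      (Finset.mem_union_right _ (Finset.mem_image_of_mem (fun t => f t - c) ht))
    rw [mem_Icc, not_and_or] at this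
    grind
  have : upCount T f c x = upCount T f c y :=
    le_antisymm
      (alternationCount_mono subset_rfl (fun t ht => (h1 t ht).1) (fun t ht => (h2 t ht).1))
      (alternationCount_mono subset_rfl (fun t ht => (h1 t ht).2) (fun t ht => (h2 t ht).2))
  simp only [this]

/-! ### Reduction to finitely many times -/

/-- The graph of any real function over a set of reals is a separable metric space. -/
lemma exists_countable_graph_dense (A : Set ℝ) (f : ℝ → ℝ) :
    ∃ D ⊆ A, D.Countable ∧
      ∀ s ∈ A, ∀ ε > 0, ∃ s' ∈ D, |s' - s| < ε ∧ |f s' - f s| < ε := by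
  obtain ⟨E, hEc, hEd⟩ :=
    TopologicalSpace.exists_countable_dense (((fun t => (t, f t)) '' A : Set (ℝ × ℝ)))
  refine ⟨(fun p => p.1.1) '' E, ?_, hEc.image _, fun s hs ε hε => ?_⟩
  · rintro _ ⟨⟨_, t, ht, rfl⟩, -, rfl⟩
    exact ht
  · obtain ⟨q, hq, hd⟩ := hEd.exists_dist_lt ⟨(s, f s), s, hs, rfl⟩ hε
    refine ⟨_, ⟨q, hq, rfl⟩, ?_⟩
    obtain ⟨_, t, ht, rfl⟩ := q
    rw [Subtype.dist_eq, Prod.dist_eq, max_lt_iff, Real.dist_eq, Real.dist_eq] at hd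
    exact ⟨by rw [abs_sub_comm]; exact hd.1, by rw [abs_sub_comm]; exact hd.2⟩

/-- Since the crossing conditions are strict, a chain can be moved into a set of times over which
the graph of `f` is dense; `x` has to be lowered to leave room for the next pair. -/
lemma AlternatesBefore.exists_lt_of_graph_dense {A D : Set ℝ} {f : ℝ → ℝ}
    (hD : ∀ s ∈ A, ∀ ε > 0, ∃ s' ∈ D, |s' - s| < ε ∧ |f s' - f s| < ε) {c y : ℝ} {n : ℕ} {x : ℝ}
    (h : AlternatesBefore A (fun t => f t < y) (fun t => y + c < f t) n x) :
    ∃ x' < x, AlternatesBefore D (fun t => f t < y) (fun t => y + c < f t) n x' := by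
  induction n generalizing x with
  | zero => exact ⟨x - 1, by linarith, trivial⟩
  | succ n ih =>
    obtain ⟨s, hs, t, ht, hst, htx, hPs, hQt, h⟩ := h
    obtain ⟨s₀, hs₀, h⟩ := ih h
    obtain ⟨s', hs', h1, h2⟩ := hD s hs (min (min (s - s₀) ((t - s) / 2)) (y - f s)) (by grind)
    obtain ⟨t', ht', h3, h4⟩ :=
      hD t ht (min (min (x - t) ((t - s) / 2)) (f t - (y + c))) (by grind)
    simp only [lt_min_iff, abs_lt] at h1 h2 h3 h4
    refine ⟨(t' + x) / 2, by linarith, s', hs', t', ht', by linarith, by linarith, by linarith,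
      by linarith, h.mono_right (by linarith)⟩

/-- A chain uses finitely many times, so it lies in one member of an increasing sequence of sets. -/
lemma AlternatesBefore.exists_of_iUnion {T : ℕ → Set ℝ} (hT : Monotone T) {P Q : ℝ → Prop} {n : ℕ}
    {x : ℝ} (h : AlternatesBefore (⋃ k, T k) P Q n x) : ∃ k, AlternatesBefore (T k) P Q n x := by
  induction n generalizing x with
  | zero => exact ⟨0, trivial⟩
  | succ n ih =>
    obtain ⟨s, hs, t, ht, hst, htx, hPs, hQt, h⟩ := h
    obtain ⟨k, h⟩ := ih h
    obtain ⟨i, hi⟩ := mem_iUnion.1 hs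
    obtain ⟨j, hj⟩ := mem_iUnion.1 ht
    let N := max k (max i j)
    exact ⟨N, s, hT (by grind) hi, t, hT (by grind) hj, hst, htx, hPs, hQt,
      h.mono (hT (by grind)) (fun _ _ h => h) (fun _ _ h => h)⟩

/-- The crossing counts along suitable finite sets of times exhaust the full crossing count at
every level. -/
lemma exists_finset_exhaustion (A : Set ℝ) (f : ℝ → ℝ) :
    ∃ T : ℕ → Finset ℝ, Monotone T ∧ (∀ k, (T k : Set ℝ) ⊆ A) ∧
      ∀ (c y : ℝ) (n : ℕ), (n : ℕ∞) ≤ upCount A f c y → ∃ k, (n : ℕ∞) ≤ upCount (T k) f c y := by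
  classical
  obtain ⟨D, hDA, hDc, hD⟩ := exists_countable_graph_dense A f
  obtain ⟨e, he⟩ : ∃ T : ℕ → Finset ℝ, Monotone T ∧ D = ⋃ k, (T k : Set ℝ) := by
    rcases D.eq_empty_or_nonempty with rfl | hne
    · exact ⟨fun _ => ∅, fun _ _ _ => le_rfl, by simp⟩
    · obtain ⟨d, rfl⟩ := hDc.exists_eq_range hne
      refine ⟨fun k => (Finset.range k).image d,
        fun i j hij => Finset.image_subset_image (Finset.range_mono hij), ?_⟩
      ext x
      simp only [mem_range, mem_iUnion, Finset.coe_image, mem_image, Finset.coe_range, mem_Iio]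
      exact ⟨fun ⟨i, hi⟩ => ⟨i + 1, i, by omega, hi⟩, fun ⟨_, i, _, hi⟩ => ⟨i, hi⟩⟩
  refine ⟨e, he.1, fun k => ?_, fun c y n hn => ?_⟩
  · exact (he.2 ▸ subset_iUnion (fun k => (e k : Set ℝ)) k).trans hDA
  · obtain ⟨x, hx⟩ := natCast_le_alternationCount.1 hn
    obtain ⟨x', -, hx'⟩ := hx.exists_lt_of_graph_dense hD
    rw [he.2] at hx'
    obtain ⟨k, hk⟩ := hx'.exists_of_iUnion fun i j hij => Finset.coe_subset.2 (he.1 hij)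
    exact ⟨k, natCast_le_alternationCount.2 ⟨_, hk⟩⟩

lemma isPointwiseLimitOfStepFunctions_upCount {A : Set ℝ} {f : ℝ → ℝ} {c : ℝ}
    (hfin : ∀ y, upCount A f c y ≠ ⊤) :
    IsPointwiseLimitOfStepFunctions fun y => ((upCount A f c y).toNat : ℝ) := by
  obtain ⟨T, hTm, hTA, hT⟩ := exists_finset_exhaustion A f
  refine ⟨fun k y => ((upCount (T k) f c y).toNat : ℝ),
    fun k => isStepFunction_upCount_finset _ _ _, fun y => ?_⟩
  obtain ⟨n, hn⟩ := ENat.ne_top_iff_exists.1 (hfin y)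
  obtain ⟨k₀, hk₀⟩ := hT c y n hn.le
  refine tendsto_const_nhds.congr' ?_
  filter_upwards [eventually_ge_atTop k₀] with k hk
  have : upCount (T k) f c y = upCount A f c y :=
    le_antisymm (upCount_mono (hTA k) f c y)
      (hn ▸ hk₀.trans (upCount_mono (Finset.coe_subset.2 (hTm hk)) f c y))
  rw [this]

lemma isPointwiseLimitOfStepFunctions_comp_neg_sub {F : ℝ → ℝ}
    (hF : IsPointwiseLimitOfStepFunctions F) (c : ℝ) :
    IsPointwiseLimitOfStepFunctions fun y => F (-y - c) := by
  classical
  obtain ⟨φ, hφ, hlim⟩ := hF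
  refine ⟨fun k y => φ k (-y - c), fun k => ?_, fun y => hlim _⟩
  obtain ⟨S, hS⟩ := hφ k
  refine ⟨S.image (fun s => -s - c), fun x y hxy h => (hS _ _ (by linarith) ?_).symm⟩
  intro s hs hmem
  refine h _ (Finset.mem_image_of_mem (fun s => -s - c) hs) ⟨?_, ?_⟩ <;>
    linarith [hmem.1, hmem.2]

lemma lintegral_upCount_eq_iSup {A : Set ℝ} {f : ℝ → ℝ} {T : ℕ → Finset ℝ} (hTm : Monotone T)
    (hTA : ∀ k, (T k : Set ℝ) ⊆ A) {c : ℝ}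
    (hT : ∀ (y : ℝ) (n : ℕ), (n : ℕ∞) ≤ upCount A f c y → ∃ k, (n : ℕ∞) ≤ upCount (T k) f c y) :
    ∫⁻ y, (upCount A f c y : ℝ≥0∞) = ⨆ k, ∫⁻ y, (upCount (T k) f c y : ℝ≥0∞) := by
  rw [← lintegral_iSup (fun k => measurable_upCount _ _ _)
    (fun i j hij y => ENat.toENNReal_le.2 (upCount_mono (Finset.coe_subset.2 (hTm hij)) f c y))]
  congr 1
  funext y
  rw [← ENat.toENNReal_iSup]
  congr 1
  refine le_antisymm ?_ (iSup_le fun k => upCount_mono (hTA k) f c y)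
  refine ENat.forall_natCast_le_iff_le.1 fun n hn => ?_
  obtain ⟨k, hk⟩ := hT y n hn
  exact hk.trans (le_iSup (fun k => upCount (T k : Set ℝ) f c y) k)

/-! ### Truncated variation is at most the integral of the crossing count -/

lemma lintegral_indicator_sum_one (n : ℕ) {S : ℕ → Set ℝ} (hS : ∀ i, MeasurableSet (S i)) :
    ∫⁻ y, ∑ i ∈ Finset.range n, (S i).indicator 1 y = ∑ i ∈ Finset.range n, volume (S i) := by
  rw [lintegral_finsetSum _ fun i _ => measurable_one.indicator (hS i)]
  simp only [lintegral_indicator_one (hS _)]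

/-- The steps of a partition that jump over `[y, y + c]` form an alternating chain: two successive
steps cannot both do so, so the chain can be kept strict. -/
lemma card_upward_steps_le_upCount {A : Set ℝ} {f : ℝ → ℝ} {c : ℝ} (hc : 0 < c) {n : ℕ}
    {t : ℕ → ℝ} (ht : StrictMonoOn t (Iic n)) (hA : ∀ i ≤ n, t i ∈ A) (y : ℝ) :
    (((Finset.range n).filter fun i => f (t i) < y ∧ y + c < f (t (i + 1))).card : ℕ∞) ≤
      upCount A f c y := by
  have key (k : ℕ) (hk : k ≤ n) :
      (∀ x > t k, AlternatesBefore A (fun t => f t < y) (fun t => y + c < f t)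
        ((Finset.range k).filter fun i => f (t i) < y ∧ y + c < f (t (i + 1))).card x) ∧
      (f (t k) ≤ y + c → AlternatesBefore A (fun t => f t < y) (fun t => y + c < f t)
        ((Finset.range k).filter fun i => f (t i) < y ∧ y + c < f (t (i + 1))).card (t k)) := by
    induction k with
    | zero => exact ⟨fun _ _ => trivial, fun _ => trivial⟩
    | succ k ih =>
      obtain ⟨ih1, ih2⟩ := ih (by omega)
      have hlt : t k < t (k + 1) :=
        ht (show k ≤ n by omega) (show k + 1 ≤ n by omega) (by omega)
      rw [Finset.range_add_one, Finset.filter_insert]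
      split_ifs with h
      · rw [Finset.card_insert_of_notMem (by simp)]
        refine ⟨fun x hx => ⟨t k, hA k (by omega), t (k + 1), hA _ hk, hlt, hx, h.1, h.2,
          ih2 (by linarith [h.1])⟩, fun h' => absurd h.2 (not_lt.2 h')⟩
      · exact ⟨fun x hx => ih1 x (hlt.trans hx), fun _ => ih1 _ hlt⟩
  exact natCast_le_alternationCount.2 ⟨t n + 1, (key n le_rfl).1 _ (by linarith)⟩

lemma ofReal_sum_upward_le_lintegral_upCount {A : Set ℝ} {f : ℝ → ℝ} {c : ℝ} (hc : 0 < c) {n : ℕ}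
    {t : ℕ → ℝ} (ht : StrictMonoOn t (Iic n)) (hA : ∀ i ≤ n, t i ∈ A) :
    ENNReal.ofReal (∑ i ∈ Finset.range n, max (f (t (i + 1)) - f (t i) - c) 0) ≤
      ∫⁻ y, (upCount A f c y : ℝ≥0∞) := by
  have hvol (i : ℕ) : ENNReal.ofReal (max (f (t (i + 1)) - f (t i) - c) 0) =
      volume (Ioo (f (t i)) (f (t (i + 1)) - c)) := by
    rw [Real.volume_Ioo, ENNReal.ofReal_max, ENNReal.ofReal_zero, max_eq_left zero_le]
    congr 1
    ring
  rw [ENNReal.ofReal_sum_of_nonneg fun i _ => le_max_right _ _]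
  simp only [hvol]
  rw [← lintegral_indicator_sum_one n fun i => measurableSet_Ioo]
  refine lintegral_mono fun y => ?_
  have h := ENat.toENNReal_le.2 (card_upward_steps_le_upCount (f := f) hc ht hA y)
  refine le_trans (le_of_eq ?_) h
  rw [ENat.toENNReal_coe, Finset.natCast_card_filter]
  refine Finset.sum_congr rfl fun i _ => ?_
  simp only [indicator_apply, mem_Ioo, Pi.one_apply, lt_sub_iff_add_lt]

lemma upTruncVar_le_lintegral_upCount (f : ℝ → ℝ) (a b : ℝ) {c : ℝ} (hc : 0 < c) :
    upTruncVar f a b c ≤ ∫⁻ y, (upCount (Icc a b) f c y : ℝ≥0∞) :=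
  iSup_le fun _ => iSup_le fun _ => iSup_le fun ht => iSup_le fun hA =>
    ofReal_sum_upward_le_lintegral_upCount hc ht hA

lemma downTruncVar_eq_upTruncVar_neg (f : ℝ → ℝ) (a b c : ℝ) :
    downTruncVar f a b c = upTruncVar (fun t => -f t) a b c := by
  have h (s t : ℝ) : f s - f t = -f t - -f s := by ring
  simp only [downTruncVar, upTruncVar, h]

lemma lintegral_segmentDowncrossings {a b : ℝ} (hab : a ≤ b) (f : ℝ → ℝ) (c : ℝ) :
    ∫⁻ y, (segmentDowncrossings f a b c y : ℝ≥0∞) =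
      ∫⁻ y, (upCount (Icc a b) (fun t => -f t) c y : ℝ≥0∞) := by
  simp only [segmentDowncrossings_eq_upCount_neg hab]
  have h (y : ℝ) : -y - c = -c - y := by ring
  simp only [h]
  exact lintegral_sub_left_eq_self
    (fun y => (upCount (Icc a b) (fun t => -f t) c y : ℝ≥0∞)) (-c)

/-- For `c > 0` a step contributes to at most one of the upward and downward sums. -/
lemma max_abs_sub_eq_add {c : ℝ} (hc : 0 < c) (x : ℝ) :
    max (|x| - c) 0 = max (x - c) 0 + max (-x - c) 0 := by
  rcases le_total 0 x with h | h
  · rw [abs_of_nonneg h, max_eq_right (by linarith : -x - c ≤ 0), add_zero]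
  · rw [abs_of_nonpos h, max_eq_right (by linarith : x - c ≤ 0), zero_add]

lemma truncVar_le_upTruncVar_add_downTruncVar (f : ℝ → ℝ) (a b : ℝ) {c : ℝ} (hc : 0 < c) :
    truncVar f a b c ≤ upTruncVar f a b c + downTruncVar f a b c := by
  refine iSup_le fun n => iSup_le fun t => iSup_le fun ht => iSup_le fun hA => ?_
  have h (i : ℕ) : max (|f (t (i + 1)) - f (t i)| - c) 0 =
      max (f (t (i + 1)) - f (t i) - c) 0 + max (f (t i) - f (t (i + 1)) - c) 0 := by
    rw [max_abs_sub_eq_add hc, neg_sub]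
  simp only [h]
  rw [Finset.sum_add_distrib, ENNReal.ofReal_add (Finset.sum_nonneg fun i _ => le_max_right _ _)
    (Finset.sum_nonneg fun i _ => le_max_right _ _)]
  refine add_le_add ?_ ?_
  · exact le_iSup_of_le n (le_iSup_of_le t (le_iSup₂_of_le ht hA le_rfl))
  · exact le_iSup_of_le n (le_iSup_of_le t (le_iSup₂_of_le ht hA le_rfl))

/-! ### The integral of the crossing count is at most the variation of any uniform approximant -/

/-- Between a time with `g < L` and a later one with `L ≤ g` some step passes the level `L` upwards,
because `#{upward passages before k} - 1_{L ≤ g k}` is nondecreasing in `k`. -/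
lemma card_passages_lt {g : ℕ → ℝ} {L : ℝ} {p q : ℕ} (hpq : p ≤ q) (hp : g p < L) (hq : L ≤ g q) :
    ((Finset.range p).filter fun i => g i < L ∧ L ≤ g (i + 1)).card <
      ((Finset.range q).filter fun i => g i < L ∧ L ≤ g (i + 1)).card := by
  have hmono : Monotone fun k =>
      (((Finset.range k).filter fun i => g i < L ∧ L ≤ g (i + 1)).card : ℤ) -
        if L ≤ g k then 1 else 0 := by
    refine monotone_nat_of_le_succ fun k => ?_
    rw [Finset.range_add_one, Finset.filter_insert]
    by_cases h : g k < L ∧ L ≤ g (k + 1)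
    · rw [if_pos h, Finset.card_insert_of_notMem (by simp), if_neg (not_le.2 h.1), if_pos h.2]
      push_cast
      linarith
    · rw [if_neg h]
      have : L ≤ g (k + 1) → L ≤ g k := fun h2 => not_lt.1 fun h1 => h ⟨h1, h2⟩
      split_ifs <;> first | omega | exact absurd (this ‹_›) ‹_›
  have := hmono hpq
  simp only [if_neg (not_le.2 hp), if_pos hq] at this
  omega

/-- If `g` stays within `c / 2` of `f`, then each upcrossing of `[y, y + c]` by `f` forces `g`
to pass the midpoint `y + c / 2`. -/
lemma AlternatesBefore.le_card_passages {A : Set ℝ} {f g : ℝ → ℝ} {c : ℝ}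
    (hfg : ∀ t ∈ A, |f t - g t| ≤ c / 2) {u : ℕ → ℝ} (hu : Monotone u) {N : ℕ}
    (hA : ∀ x ∈ A, ∃ i ≤ N, u i = x) {n k : ℕ} {y x : ℝ} (hk : ∀ i ≤ N, u i < x → i ≤ k)
    (h : AlternatesBefore A (fun t => f t < y) (fun t => y + c < f t) n x) :
    n ≤ ((Finset.range k).filter
      fun i => g (u i) < y + c / 2 ∧ y + c / 2 ≤ g (u (i + 1))).card := by
  induction n generalizing k x with
  | zero => exact Nat.zero_le _
  | succ n ih =>
    obtain ⟨s, hs, t, ht, hst, htx, hPs, hQt, h⟩ := h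
    obtain ⟨p, hp, rfl⟩ := hA s hs
    obtain ⟨q, hq, rfl⟩ := hA t ht
    have h1 := abs_le.1 (hfg _ hs)
    have h2 := abs_le.1 (hfg _ ht)
    have hlt := card_passages_lt (g := fun i => g (u i)) (L := y + c / 2) (p := p) (q := q)
      (hu.reflect_lt hst).le (by linarith) (by linarith)
    have hqk := Finset.card_le_card (Finset.filter_subset_filter
      (fun i => g (u i) < y + c / 2 ∧ y + c / 2 ≤ g (u (i + 1)))
      (Finset.range_mono (hk q hq htx)))
    have := ih (k := p) (fun i _ hi => (hu.reflect_lt hi).le) h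
    omega

lemma lintegral_upCount_le_sum_ofReal {A : Set ℝ} {f g : ℝ → ℝ} {c : ℝ}
    (hfg : ∀ t ∈ A, |f t - g t| ≤ c / 2) {u : ℕ → ℝ} (hu : Monotone u) {N : ℕ}
    (hA : ∀ x ∈ A, ∃ i ≤ N, u i = x) :
    ∫⁻ y, (upCount A f c y : ℝ≥0∞) ≤
      ∑ i ∈ Finset.range N, ENNReal.ofReal (g (u (i + 1)) - g (u i)) := by
  have hvol (i : ℕ) : ENNReal.ofReal (g (u (i + 1)) - g (u i)) =
      volume (Ioc (g (u i) - c / 2) (g (u (i + 1)) - c / 2)) := by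
    rw [Real.volume_Ioc]
    congr 1
    ring
  simp only [hvol]
  rw [← lintegral_indicator_sum_one N fun i => measurableSet_Ioc]
  refine lintegral_mono fun y => ?_
  have h : upCount A f c y ≤ ((Finset.range N).filter
      fun i => g (u i) < y + c / 2 ∧ y + c / 2 ≤ g (u (i + 1))).card := by
    refine iSup₂_le fun n ⟨x, hx⟩ => ?_
    exact_mod_cast hx.le_card_passages hfg hu hA fun i hi _ => hi
  refine (ENat.toENNReal_le.2 h).trans (le_of_eq ?_)
  rw [ENat.toENNReal_coe, Finset.natCast_card_filter]
  refine Finset.sum_congr rfl fun i _ => ?_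
  simp only [indicator_apply, mem_Ioc, Pi.one_apply, sub_lt_iff_lt_add, le_sub_iff_add_le]

lemma exists_monotone_enumeration {T : Finset ℝ} (hT : T.Nonempty) :
    ∃ (N : ℕ) (u : ℕ → ℝ), Monotone u ∧ (∀ i, u i ∈ T) ∧ ∀ x ∈ T, ∃ i ≤ N, u i = x := by
  have hpos := hT.card_pos
  refine ⟨T.card - 1, fun i => T.orderEmbOfFin rfl ⟨min i (T.card - 1), by omega⟩,
    fun i j hij => ?_, fun i => T.orderEmbOfFin_mem rfl _, fun x hx => ?_⟩
  · refine (T.orderEmbOfFin rfl).monotone ?_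
    simp only [Fin.mk_le_mk]
    omega
  · have : x ∈ range (T.orderEmbOfFin rfl) := by rw [T.range_orderEmbOfFin rfl]; exact hx
    obtain ⟨i, rfl⟩ := this
    refine ⟨i, by omega, ?_⟩
    exact congrArg _ (Fin.ext (min_eq_left (by omega)))

lemma lintegral_upCount_add_le_eVariationOn {A : Set ℝ} {f g : ℝ → ℝ} {c : ℝ}
    (hfg : ∀ t ∈ A, |f t - g t| ≤ c / 2) :
    (∫⁻ y, (upCount A f c y : ℝ≥0∞)) + ∫⁻ y, (upCount A (fun t => -f t) c y : ℝ≥0∞) ≤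
      eVariationOn g A := by
  classical
  have hfg' : ∀ t ∈ A, |(-f t) - (-g t)| ≤ c / 2 := fun t ht => by
    rw [neg_sub_neg, abs_sub_comm]
    exact hfg t ht
  have hfin (T : Finset ℝ) (hTA : (T : Set ℝ) ⊆ A) :
      (∫⁻ y, (upCount T f c y : ℝ≥0∞)) + ∫⁻ y, (upCount T (fun t => -f t) c y : ℝ≥0∞) ≤
        eVariationOn g A := by
    rcases T.eq_empty_or_nonempty with rfl | hne
    · have h0 (f : ℝ → ℝ) (y : ℝ) : upCount ((∅ : Finset ℝ) : Set ℝ) f c y = 0 := by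
        rw [← nonpos_iff_eq_zero]
        refine iSup₂_le fun n ⟨x, hx⟩ => ?_
        cases n with
        | zero => exact le_rfl
        | succ n =>
          obtain ⟨s, hs, -⟩ := hx
          simp at hs
      simp only [h0]
      simp
    · obtain ⟨N, u, hu, huT, hT⟩ := exists_monotone_enumeration hne
      refine (add_le_add
        (lintegral_upCount_le_sum_ofReal (fun t ht => hfg t (hTA ht)) hu hT)
        (lintegral_upCount_le_sum_ofReal (fun t ht => hfg' t (hTA ht)) hu hT)).trans ?_
      rw [← Finset.sum_add_distrib]
      refine le_trans (le_of_eq (Finset.sum_congr rfl fun i _ => ?_))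
        (eVariationOn.sum_le (n := N) hu fun i => hTA (huT i))
      rw [edist_dist, Real.dist_eq]
      rcases le_total (g (u i)) (g (u (i + 1))) with h | h
      · rw [abs_of_nonneg (by linarith), ENNReal.ofReal_of_nonpos (p := -g (u (i + 1)) - -g (u i))
          (by linarith), add_zero]
      · rw [abs_of_nonpos (by linarith), ENNReal.ofReal_of_nonpos (p := g (u (i + 1)) - g (u i))
          (by linarith), zero_add]
        congr 1
        ring
  obtain ⟨T₁, hm₁, hA₁, h₁⟩ := exists_finset_exhaustion A f
  obtain ⟨T₂, hm₂, hA₂, h₂⟩ := exists_finset_exhaustion A fun t => -f t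
  rw [lintegral_upCount_eq_iSup hm₁ hA₁ (h₁ c), lintegral_upCount_eq_iSup hm₂ hA₂ (h₂ c)]
  refine ENNReal.iSup_add_iSup_le fun i j => ?_
  refine (add_le_add ?_ ?_).trans (hfin (T₁ i ∪ T₂ j) ?_)
  · exact lintegral_mono fun y => ENat.toENNReal_le.2 (upCount_mono (by simp) _ _ _)
  · exact lintegral_mono fun y => ENat.toENNReal_le.2 (upCount_mono (by simp) _ _ _)
  · rw [Finset.coe_union]
    exact union_subset (hA₁ i) (hA₂ j)

/-! ### Finiteness of the truncated variation of a regulated function -/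

/-- If the weight of every step is at most the increment of a bounded function, then the sums
telescope. -/
lemma partitionSup_le_ofReal {a b M : ℝ} {w : ℝ → ℝ → ℝ} {H : ℝ → ℝ}
    (hw : ∀ s ∈ Icc a b, ∀ t ∈ Icc a b, s < t → w s t ≤ H t - H s) (h0 : ∀ t ∈ Icc a b, 0 ≤ H t)
    (hM : ∀ t ∈ Icc a b, H t ≤ M) : partitionSup a b w ≤ ENNReal.ofReal M := by
  refine iSup_le fun n => iSup_le fun t => iSup_le fun ht => iSup_le fun hA => ?_
  refine ENNReal.ofReal_le_ofReal ?_
  have h : ∑ i ∈ Finset.range n, w (t i) (t (i + 1)) ≤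
      ∑ i ∈ Finset.range n, (H (t (i + 1)) - H (t i)) := by
    refine Finset.sum_le_sum fun i hi => ?_
    have hi := Finset.mem_range.1 hi
    exact hw _ (hA _ hi.le) _ (hA _ hi)
      (ht (show i ≤ n by omega) (show i + 1 ≤ n by omega) (Nat.lt_succ_self i))
  rw [Finset.sum_range_sub fun i => H (t i)] at h
  linarith [h0 _ (hA 0 (Nat.zero_le n)), hM _ (hA n le_rfl)]

/-- Off finitely many points a regulated function oscillates by at most `ε`. -/
lemma IsRegulatedOn.exists_finset_oscillation_le {a b : ℝ} {f : ℝ → ℝ} (hf : IsRegulatedOn f a b)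
    {ε : ℝ} (hε : 0 < ε) :
    ∃ F : Finset ℝ, ∀ x ∈ Icc a b, ∀ y ∈ Icc a b, x ≤ y → (∀ s ∈ F, s ∉ Icc x y) →
      |f x - f y| ≤ ε := by
  classical
  have hloc : ∀ z ∈ Icc a b, ∃ δ > 0,
      (∀ x ∈ Icc a b, ∀ y ∈ Icc a b, z < x → x ≤ y → y < z + δ → |f x - f y| ≤ ε) ∧
      (∀ x ∈ Icc a b, ∀ y ∈ Icc a b, z - δ < x → x ≤ y → y < z → |f x - f y| ≤ ε) := by
    intro z hz
    obtain ⟨δ₁, hδ₁, h₁⟩ : ∃ δ > 0, ∀ x ∈ Icc a b, ∀ y ∈ Icc a b, z < x → x ≤ y → y < z + δ →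
        |f x - f y| ≤ ε := by
      rcases hz.2.eq_or_lt with rfl | hzb
      · exact ⟨1, one_pos, fun x hx y hy h => absurd hx.2 (not_le.2 h)⟩
      · obtain ⟨l, hl⟩ := hf.1 z ⟨hz.1, hzb⟩
        obtain ⟨w, hw, hw'⟩ := mem_nhdsGT_iff_exists_Ioo_subset.1
          (Metric.tendsto_nhds.1 hl (ε / 2) (by linarith))
        refine ⟨w - z, sub_pos.2 hw, fun x hx y hy h1 h2 h3 => ?_⟩
        have hx' : dist (f x) l < ε / 2 := hw' ⟨h1, by linarith⟩
        have hy' : dist (f y) l < ε / 2 := hw' ⟨by linarith, by linarith⟩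
        rw [← Real.dist_eq]
        linarith [dist_triangle_right (f x) (f y) l]
    obtain ⟨δ₂, hδ₂, h₂⟩ : ∃ δ > 0, ∀ x ∈ Icc a b, ∀ y ∈ Icc a b, z - δ < x → x ≤ y → y < z →
        |f x - f y| ≤ ε := by
      rcases hz.1.eq_or_lt with rfl | hza
      · exact ⟨1, one_pos, fun x hx y hy _ _ h => absurd hy.1 (not_le.2 h)⟩
      · obtain ⟨l, hl⟩ := hf.2 z ⟨hza, hz.2⟩
        obtain ⟨w, hw, hw'⟩ := mem_nhdsLT_iff_exists_Ioo_subset.1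
          (Metric.tendsto_nhds.1 hl (ε / 2) (by linarith))
        refine ⟨z - w, sub_pos.2 hw, fun x hx y hy h1 h2 h3 => ?_⟩
        have hx' : dist (f x) l < ε / 2 := hw' ⟨by linarith, by linarith⟩
        have hy' : dist (f y) l < ε / 2 := hw' ⟨by linarith, by linarith⟩
        rw [← Real.dist_eq]
        linarith [dist_triangle_right (f x) (f y) l]
    exact ⟨min δ₁ δ₂, lt_min hδ₁ hδ₂,
      fun x hx y hy h1 h2 h3 => h₁ x hx y hy h1 h2 (h3.trans_le (by gcongr; exact min_le_left _ _)),
      fun x hx y hy h1 h2 h3 =>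
        h₂ x hx y hy (lt_of_le_of_lt (by gcongr; exact min_le_right _ _) h1) h2 h3⟩
  choose! δ hδ h₁ h₂ using hloc
  obtain ⟨C, hC, hcov⟩ := isCompact_Icc.elim_nhds_subcover (fun z => Ioo (z - δ z) (z + δ z))
    fun z hz => Ioo_mem_nhds (by linarith [hδ z hz]) (by linarith [hδ z hz])
  -- Without a centre or an end of a covering interval in between, `x` and `y` lie on the same side
  -- of the centre of one covering interval.
  refine ⟨C ∪ (C.image (fun z => z - δ z) ∪ C.image (fun z => z + δ z)),
    fun x hx y hy hxy hF => ?_⟩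
  obtain ⟨z, hzC, hz⟩ := mem_iUnion₂.1 (hcov hx)
  have e1 := hF z (by simp [hzC])
  have e3 := hF (z + δ z) (Finset.mem_union_right _
    (Finset.mem_union_right _ (Finset.mem_image_of_mem (fun z => z + δ z) hzC)))
  rw [mem_Icc, not_and_or, not_le, not_le] at e1 e3
  have hy2 : y < z + δ z := e3.resolve_left (by linarith [hz.2])
  rcases e1 with h | h
  · exact h₁ z (hC z hzC) x hx y hy h hxy hy2
  · exact h₂ z (hC z hzC) x hx y hy hz.1 hxy h

lemma IsRegulatedOn.exists_abs_le {a b : ℝ} {f : ℝ → ℝ} (hf : IsRegulatedOn f a b) :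
    ∃ M, ∀ t ∈ Icc a b, |f t| ≤ M := by
  refine isCompact_Icc.induction_on (p := fun S => ∃ M, ∀ t ∈ S, |f t| ≤ M) ⟨0, by simp⟩
    (fun S T hST ⟨M, hM⟩ => ⟨M, fun t ht => hM t (hST ht)⟩)
    (fun S T ⟨M, hM⟩ ⟨N, hN⟩ => ⟨max M N, fun t ht => ?_⟩) fun z hz => ?_
  · rcases ht with ht | ht
    · exact (hM t ht).trans (le_max_left _ _)
    · exact (hN t ht).trans (le_max_right _ _)
  · have hr : ∃ M, ∀ᶠ x in 𝓝[Icc a b] z, z < x → |f x| ≤ M := by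
      rcases hz.2.eq_or_lt with rfl | hzb
      · exact ⟨0, eventually_mem_nhdsWithin.mono fun x hx h => absurd hx.2 (not_le.2 h)⟩
      · obtain ⟨l, hl⟩ := hf.1 z ⟨hz.1, hzb⟩
        have := eventually_nhdsWithin_iff.1 (hl.abs.eventually_le_const (lt_add_one |l|))
        exact ⟨_, this.filter_mono nhdsWithin_le_nhds⟩
    have hl : ∃ M, ∀ᶠ x in 𝓝[Icc a b] z, x < z → |f x| ≤ M := by
      rcases hz.1.eq_or_lt with rfl | hza
      · exact ⟨0, eventually_mem_nhdsWithin.mono fun x hx h => absurd hx.1 (not_le.2 h)⟩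
      · obtain ⟨l, hl⟩ := hf.2 z ⟨hza, hz.2⟩
        have := eventually_nhdsWithin_iff.1 (hl.abs.eventually_le_const (lt_add_one |l|))
        exact ⟨_, this.filter_mono nhdsWithin_le_nhds⟩
    obtain ⟨M, hM⟩ := hr
    obtain ⟨N, hN⟩ := hl
    refine ⟨_, hM.and hN, max (max M N) |f z|, fun x hx => ?_⟩
    rcases lt_trichotomy x z with h | rfl | h
    · exact (hx.2 h).trans ((le_max_right _ _).trans (le_max_left _ _))
    · exact le_max_right _ _
    · exact (hx.1 h).trans ((le_max_left _ _).trans (le_max_left _ _))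

/-- Only the steps that meet one of finitely many points contribute, and `#{F < t} + #{F ≤ t}`
grows along every such step. -/
lemma IsRegulatedOn.truncVar_ne_top {a b : ℝ} {f : ℝ → ℝ} (hf : IsRegulatedOn f a b)
    {c : ℝ} (hc : 0 < c) : truncVar f a b c ≠ ⊤ := by
  classical
  obtain ⟨F, hF⟩ := hf.exists_finset_oscillation_le hc
  obtain ⟨M, hM⟩ := hf.exists_abs_le
  let h : ℝ → ℕ := fun t => (F.filter (· < t)).card + (F.filter (· ≤ t)).card
  let K : ℝ := max (2 * M) 0
  refine ne_top_of_le_ne_top ENNReal.ofReal_ne_top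
    (partitionSup_le_ofReal (H := fun t => K * h t) (M := K * (F.card + F.card))
      (fun s hs t ht hst => ?_) (fun t _ => by positivity) fun t _ => ?_)
  · have hlt : F.filter (· < s) ⊆ F.filter (· < t) :=
      Finset.monotone_filter_right _ fun x _ hx => lt_trans hx hst
    have hle : F.filter (· ≤ s) ⊆ F.filter (· ≤ t) :=
      Finset.monotone_filter_right _ fun x _ hx => le_trans hx hst.le
    by_cases hmeet : ∀ x ∈ F, x ∉ Icc s t
    · have h1 := hF s hs t ht hst.le hmeet
      have h2 : h s ≤ h t := add_le_add (Finset.card_le_card hlt) (Finset.card_le_card hle)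
      rw [abs_sub_comm] at h1
      rw [max_eq_right (by linarith), ← mul_sub]
      exact mul_nonneg (le_max_right _ _) (sub_nonneg.2 (by exact_mod_cast h2))
    · push Not at hmeet
      obtain ⟨x, hxF, hx⟩ := hmeet
      have h2 : h s + 1 ≤ h t := by
        rcases hx.2.eq_or_lt with rfl | hxt
        · have := Finset.card_lt_card (hle.ssubset_of_mem_notMem (a := x) (by simp [hxF])
            (by simp [hst]))
          have := Finset.card_le_card hlt
          simp only [h]
          omega
        · have := Finset.card_lt_card (hlt.ssubset_of_mem_notMem (a := x) (by simp [hxF, hxt])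
            (by simp [hx.1]))
          have := Finset.card_le_card hle
          simp only [h]
          omega
      have h3 : (h s : ℝ) + 1 ≤ h t := by exact_mod_cast h2
      have h4 : |f t - f s| ≤ 2 * M := by
        linarith [abs_sub (f t) (f s), hM s hs, hM t ht]
      calc max (|f t - f s| - c) 0 ≤ K := max_le_max (by linarith) le_rfl
        _ ≤ K * (h t - h s) := le_mul_of_one_le_right (le_max_right _ _) (by linarith)
        _ = K * h t - K * h s := mul_sub _ _ _
  · refine mul_le_mul_of_nonneg_left ?_ (le_max_right _ _)
    exact_mod_cast add_le_add (Finset.card_filter_le _ _) (Finset.card_filter_le _ _)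

/-! ### An optimal uniform approximant -/

/-- Some partition in `[a, b]` with last point `p` has truncated variation sum at least `S`. -/
def HasPartitionSum (f : ℝ → ℝ) (a b c p S : ℝ) : Prop :=
  ∃ (n : ℕ) (t : ℕ → ℝ), StrictMonoOn t (Iic n) ∧ (∀ i ≤ n, t i ∈ Icc a b) ∧ t n = p ∧
    S ≤ ∑ i ∈ Finset.range n, max (|f (t (i + 1)) - f (t i)| - c) 0

section Approximant

variable {f : ℝ → ℝ} {a b c p q S : ℝ}

lemma hasPartitionSum_zero (hp : p ∈ Icc a b) : HasPartitionSum f a b c p 0 := by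
  refine ⟨0, fun _ => p, fun i hi j hj hij => ?_, fun _ _ => hp, rfl, by simp⟩
  have hj : j ≤ 0 := hj
  omega

lemma HasPartitionSum.extend (h : HasPartitionSum f a b c p S) (hpq : p < q) (hq : q ∈ Icc a b) :
    HasPartitionSum f a b c q (S + max (|f q - f p| - c) 0) := by
  obtain ⟨n, t, ht, hA, rfl, hS⟩ := h
  refine ⟨n + 1, fun i => if i ≤ n then t i else q, fun i hi j hj hij => ?_, fun i _ => ?_,
    by simp, ?_⟩
  · have hj : j ≤ n + 1 := hj
    have hin : i ≤ n := by omega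
    simp only [if_pos hin]
    split_ifs with hjn
    · exact ht hin hjn hij
    · exact (ht.monotoneOn hin (le_refl n) hin).trans_lt hpq
  · dsimp only
    split_ifs with hi
    · exact hA i hi
    · exact hq
  · rw [Finset.sum_range_succ]
    refine add_le_add (hS.trans (le_of_eq (Finset.sum_congr rfl fun i hi => ?_))) (by simp)
    have hi := Finset.mem_range.1 hi
    simp only [if_pos hi.le, if_pos (show i + 1 ≤ n from hi)]

lemma HasPartitionSum.mono {S' : ℝ} (h : HasPartitionSum f a b c p S) (hS : S' ≤ S) :
    HasPartitionSum f a b c p S' := by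
  obtain ⟨n, t, ht, hA, hp, hle⟩ := h
  exact ⟨n, t, ht, hA, hp, hS.trans hle⟩

lemma HasPartitionSum.le_toReal_truncVar (h : HasPartitionSum f a b c p S)
    (hfin : truncVar f a b c ≠ ⊤) : S ≤ (truncVar f a b c).toReal := by
  obtain ⟨n, t, ht, hA, rfl, hS⟩ := h
  refine hS.trans ((ENNReal.ofReal_le_iff_le_toReal hfin).1 ?_)
  exact le_iSup_of_le n (le_iSup_of_le t (le_iSup₂_of_le ht hA le_rfl))

/-- `g` is within `c / 2` of `f` on `T`, the function `V` bounds the variation of `g` along `T`,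
and continuing `g` by the value `z` gives total variation at most `m`. -/
structure IsApproximantEndingAt (f : ℝ → ℝ) (c : ℝ) (T : Set ℝ) (m z : ℝ) (g V : ℝ → ℝ) :
    Prop where
  abs_sub_le : ∀ t ∈ T, |f t - g t| ≤ c / 2
  variation_le : ∀ s ∈ T, ∀ t ∈ T, s ≤ t → |g t - g s| ≤ V t - V s
  nonneg : ∀ t ∈ T, 0 ≤ V t
  final_le : ∀ t ∈ T, |z - g t| ≤ m - V t

/-- The state of a dynamic programme over the finitely many times `T`. The least variation of an
approximant of `f` on `T` is `m`, and `[α, β]` is the set of last values with which it is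
attained. The last three fields are dual certificates: partitions whose truncated variation sums
show that `m` is optimal, also after the path of `f` leaves `[α, β]` upwards or downwards. -/
structure IsOptimalState (f : ℝ → ℝ) (a b c : ℝ) (T : Set ℝ) (m α β : ℝ) : Prop where
  le : α ≤ β
  nonneg : 0 ≤ m
  primal : ∀ z ∈ Icc α β, ∃ g V, IsApproximantEndingAt f c T m z g V
  up : ∃ p ∈ T, HasPartitionSum f a b c p (m - β + f p + c / 2)
  down : ∃ p ∈ T, HasPartitionSum f a b c p (m + α - f p + c / 2)
  attained : ∃ p ∈ T, HasPartitionSum f a b c p m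

/-- An approximant is continued to a later time `t` by a new value `z'`. -/
lemma IsApproximantEndingAt.insert {T : Set ℝ} {m m' z z' t : ℝ} {g V : ℝ → ℝ}
    (h : IsApproximantEndingAt f c T m z g V) (hm : 0 ≤ m) (hT : ∀ x ∈ T, x < t)
    (hz' : |f t - z'| ≤ c / 2) (hm' : m + |z' - z| ≤ m') :
    IsApproximantEndingAt f c (insert t T) m' z' (Function.update g t z')
      (Function.update V t m') := by
  have hupd (u : ℝ → ℝ) (w x : ℝ) (hx : x ∈ T) : Function.update u t w x = u x :=
    Function.update_of_ne (hT x hx).ne _ _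
  have hfin : ∀ x ∈ T, |z' - g x| ≤ m' - V x := fun x hx => by
    linarith [_root_.abs_sub_le z' z (g x), h.final_le x hx]
  have hm0 : 0 ≤ m' := by linarith [abs_nonneg (z' - z)]
  constructor
  · rintro x (rfl | hx)
    · simpa using hz'
    · rw [hupd _ _ x hx]
      exact h.abs_sub_le x hx
  · rintro x (rfl | hx) y (rfl | hy) hxy
    · simp
    · exact absurd (hT y hy) (not_lt.2 hxy)
    · rw [hupd _ _ x hx, hupd _ _ x hx]
      simpa using hfin x hx
    · rw [hupd _ _ x hx, hupd _ _ x hx, hupd _ _ y hy, hupd _ _ y hy]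
      exact h.variation_le x hx y hy hxy
  · rintro x (rfl | hx)
    · simpa using hm0
    · rw [hupd _ _ x hx]
      exact h.nonneg x hx
  · rintro x (rfl | hx)
    · simp
    · rw [hupd _ _ x hx, hupd _ _ x hx]
      exact hfin x hx

lemma isOptimalState_singleton (hc : 0 < c) {t : ℝ} (ht : t ∈ Icc a b) :
    IsOptimalState f a b c {t} 0 (f t - c / 2) (f t + c / 2) where
  le := by linarith
  nonneg := le_rfl
  primal z hz := by
    refine ⟨fun _ => z, fun _ => 0, ?_, ?_, ?_, ?_⟩
    · rintro x rfl
      exact abs_le.2 ⟨by linarith [hz.2], by linarith [hz.1]⟩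
    all_goals simp
  up := ⟨t, rfl, (hasPartitionSum_zero ht).mono (by linarith)⟩
  down := ⟨t, rfl, (hasPartitionSum_zero ht).mono (by linarith)⟩
  attained := ⟨t, rfl, hasPartitionSum_zero ht⟩

/-- One step of the dynamic programme: the new set of optimal last values is the intersection of
`[α, β]` with `[f t - c / 2, f t + c / 2]` if they meet, and otherwise the point of the latter
interval nearest to `[α, β]`. -/
lemma IsOptimalState.insert {T : Set ℝ} {m α β t : ℝ} (h : IsOptimalState f a b c T m α β)
    (hT : ∀ x ∈ T, x < t) (ht : t ∈ Icc a b) (hc : 0 < c) :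
    ∃ m' α' β', IsOptimalState f a b c (insert t T) m' α' β' := by
  obtain ⟨p, hp, hup⟩ := h.up
  obtain ⟨q, hq, hdown⟩ := h.down
  obtain ⟨r, hr, hatt⟩ := h.attained
  have hab := h.le
  rcases lt_or_ge β (f t - c / 2) with h1 | h1
  · have hs : HasPartitionSum f a b c t (m + (f t - c / 2 - β)) :=
      (hup.extend (hT p hp) ht).mono
        (by linarith [le_max_left (|f t - f p| - c) 0, le_abs_self (f t - f p)])
    refine ⟨m + (f t - c / 2 - β), f t - c / 2, f t - c / 2, le_rfl, by linarith [h.nonneg],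
      fun z hz => ?_, ⟨p, mem_insert_of_mem _ hp, hup.mono (by linarith)⟩,
      ⟨t, mem_insert _ _, hs.mono (by linarith)⟩, ⟨t, mem_insert _ _, hs⟩⟩
    obtain ⟨g, V, hg⟩ := h.primal β ⟨h.le, le_rfl⟩
    obtain rfl : z = f t - c / 2 := le_antisymm hz.2 hz.1
    exact ⟨_, _, hg.insert h.nonneg hT (abs_le.2 ⟨by linarith, by linarith⟩)
      (by rw [abs_of_nonneg (by linarith)])⟩
  rcases lt_or_ge (f t + c / 2) α with h2 | h2
  · have hs : HasPartitionSum f a b c t (m + (α - (f t + c / 2))) :=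
      (hdown.extend (hT q hq) ht).mono
        (by linarith [le_max_left (|f t - f q| - c) 0, neg_le_abs (f t - f q)])
    refine ⟨m + (α - (f t + c / 2)), f t + c / 2, f t + c / 2, le_rfl, by linarith [h.nonneg],
      fun z hz => ?_, ⟨t, mem_insert _ _, hs.mono (by linarith)⟩,
      ⟨q, mem_insert_of_mem _ hq, hdown.mono (by linarith)⟩, ⟨t, mem_insert _ _, hs⟩⟩
    obtain ⟨g, V, hg⟩ := h.primal α ⟨le_rfl, h.le⟩
    obtain rfl : z = f t + c / 2 := le_antisymm hz.2 hz.1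
    exact ⟨_, _, hg.insert h.nonneg hT (abs_le.2 ⟨by linarith, by linarith⟩)
      (by rw [abs_of_nonpos (by linarith)]; linarith)⟩
  have hs : HasPartitionSum f a b c t m :=
    (hatt.extend (hT r hr) ht).mono (le_add_of_nonneg_right (le_max_right _ _))
  refine ⟨m, max α (f t - c / 2), min β (f t + c / 2), ?_, h.nonneg, fun z hz => ?_, ?_, ?_,
    ⟨t, mem_insert _ _, hs⟩⟩
  · exact max_le (le_min h.le h2) (le_min h1 (by linarith))
  · obtain ⟨hz1, hz2⟩ := max_le_iff.1 hz.1
    obtain ⟨hz3, hz4⟩ := le_min_iff.1 hz.2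
    obtain ⟨g, V, hg⟩ := h.primal z ⟨hz1, hz3⟩
    exact ⟨_, _, hg.insert h.nonneg hT (abs_le.2 ⟨by linarith, by linarith⟩) (by simp)⟩
  · rcases min_choice β (f t + c / 2) with h3 | h3 <;> rw [h3]
    · exact ⟨p, mem_insert_of_mem _ hp, hup⟩
    · exact ⟨t, mem_insert _ _, hs.mono (by linarith)⟩
  · rcases max_choice α (f t - c / 2) with h3 | h3 <;> rw [h3]
    · exact ⟨q, mem_insert_of_mem _ hq, hdown⟩
    · exact ⟨t, mem_insert _ _, hs.mono (by linarith)⟩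

lemma exists_isOptimalState (hc : 0 < c) (T : Finset ℝ) (hT : T.Nonempty)
    (hTab : ∀ t ∈ T, t ∈ Icc a b) :
    ∃ m α β, IsOptimalState f a b c (T : Set ℝ) m α β := by
  induction T using Finset.induction_on_max with
  | empty => exact absurd hT Finset.not_nonempty_empty
  | insert t T hlt ih =>
    have ht := hTab t (Finset.mem_insert_self _ _)
    rw [Finset.coe_insert]
    rcases T.eq_empty_or_nonempty with rfl | hne
    · rw [Finset.coe_empty, insert_empty_eq]
      exact ⟨_, _, _, isOptimalState_singleton hc ht⟩
    · obtain ⟨m, α, β, h⟩ := ih hne fun s hs => hTab s (Finset.mem_insert_of_mem hs)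
      exact h.insert hlt ht hc

/-- On finitely many times, `f` has an approximant whose variation is at most the truncated
variation of `f`. -/
lemma exists_approximant_finset (hc : 0 < c) (hfin : truncVar f a b c ≠ ⊤) (T : Finset ℝ)
    (hTab : ∀ t ∈ T, t ∈ Icc a b) :
    ∃ g V : ℝ → ℝ, (∀ t ∈ T, |f t - g t| ≤ c / 2) ∧
      (∀ t ∈ T, 0 ≤ V t ∧ V t ≤ (truncVar f a b c).toReal) ∧
      ∀ s ∈ T, ∀ t ∈ T, s ≤ t → |g t - g s| ≤ V t - V s := by
  rcases T.eq_empty_or_nonempty with rfl | hne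
  · exact ⟨0, 0, by simp⟩
  · obtain ⟨m, α, β, h⟩ := exists_isOptimalState (f := f) hc T hne hTab
    obtain ⟨g, V, hg⟩ := h.primal α ⟨le_rfl, h.le⟩
    obtain ⟨p, -, hp⟩ := h.attained
    have hm := hp.le_toReal_truncVar hfin
    exact ⟨g, V, hg.abs_sub_le, fun t ht => ⟨hg.nonneg t ht,
      by linarith [hg.final_le t ht, abs_nonneg (α - g t)]⟩, hg.variation_le⟩

/-- The infimum in the variational formula is at most the truncated variation, and is attained: by
Tychonoff's theorem the approximants on finite sets of times have a common cluster point. -/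
lemma exists_approximant (hc : 0 < c) (hfin : truncVar f a b c ≠ ⊤) :
    ∃ g : ℝ → ℝ, (∀ t ∈ Icc a b, |f t - g t| ≤ c / 2) ∧
      eVariationOn g (Icc a b) ≤ truncVar f a b c := by
  classical
  set M := (truncVar f a b c).toReal with hM
  have hM0 : 0 ≤ M := ENNReal.toReal_nonneg
  have hK : IsCompact ((univ.pi fun t : ℝ => Icc (f t - c / 2) (f t + c / 2)) ×ˢ
      (univ.pi fun _ : ℝ => Icc 0 M)) :=
    (isCompact_univ_pi fun _ => isCompact_Icc).prod (isCompact_univ_pi fun _ => isCompact_Icc)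
  obtain ⟨⟨g, V⟩, ⟨hg, hV⟩, hgV⟩ := hK.inter_iInter_nonempty
    (fun q : {q : ℝ × ℝ // q.1 ∈ Icc a b ∧ q.2 ∈ Icc a b ∧ q.1 ≤ q.2} =>
      {h : (ℝ → ℝ) × (ℝ → ℝ) | |h.1 q.1.2 - h.1 q.1.1| ≤ h.2 q.1.2 - h.2 q.1.1})
    (fun q => isClosed_le (by fun_prop) (by fun_prop)) (fun U => by
      let T : Finset ℝ := U.image (fun q => q.1.1) ∪ U.image (fun q => q.1.2)
      have hTab : ∀ t ∈ T, t ∈ Icc a b := by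
        intro t ht
        rcases Finset.mem_union.1 ht with ht | ht <;>
          obtain ⟨q, -, rfl⟩ := Finset.mem_image.1 ht
        · exact q.2.1
        · exact q.2.2.1
      obtain ⟨g, V, hg, hV, hgV⟩ := exists_approximant_finset hc hfin T hTab
      refine ⟨(fun t => if t ∈ T then g t else f t, fun t => if t ∈ T then V t else 0),
        ⟨fun t _ => ?_, fun t _ => ?_⟩, mem_iInter₂.2 fun q hq => ?_⟩
      · dsimp only
        split_ifs with ht
        · have := abs_le.1 (hg t ht)
          exact ⟨by linarith, by linarith⟩
        · exact ⟨by linarith, by linarith⟩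
      · dsimp only
        split_ifs with ht
        · exact hV t ht
        · exact ⟨le_rfl, hM0⟩
      · have h1 : q.1.1 ∈ T :=
          Finset.mem_union_left _ (Finset.mem_image_of_mem (fun q => q.1.1) hq)
        have h2 : q.1.2 ∈ T :=
          Finset.mem_union_right _ (Finset.mem_image_of_mem (fun q => q.1.2) hq)
        change |(if q.1.2 ∈ T then g q.1.2 else f q.1.2) -
          (if q.1.1 ∈ T then g q.1.1 else f q.1.1)| ≤
          (if q.1.2 ∈ T then V q.1.2 else 0) - (if q.1.1 ∈ T then V q.1.1 else 0)
        simp only [if_pos h1, if_pos h2]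
        exact hgV _ h1 _ h2 q.2.2.2)
  refine ⟨g, fun t _ => ?_, ?_⟩
  · have := hg t trivial
    exact abs_le.2 ⟨by linarith [this.2], by linarith [this.1]⟩
  · rw [← ENNReal.ofReal_toReal hfin]
    refine iSup_le fun ⟨n, u, hu, huA⟩ => ?_
    have hstep (i : ℕ) : edist (g (u (i + 1))) (g (u i)) ≤
        ENNReal.ofReal (V (u (i + 1)) - V (u i)) := by
      rw [edist_dist, Real.dist_eq]
      exact ENNReal.ofReal_le_ofReal
        (mem_iInter.1 hgV ⟨(u i, u (i + 1)), huA _, huA _, hu (Nat.le_succ i)⟩)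
    have hnonneg (i : ℕ) : 0 ≤ V (u (i + 1)) - V (u i) :=
      (abs_nonneg _).trans
        (mem_iInter.1 hgV ⟨(u i, u (i + 1)), huA _, huA _, hu (Nat.le_succ i)⟩)
    refine (Finset.sum_le_sum fun i _ => hstep i).trans ?_
    rw [← ENNReal.ofReal_sum_of_nonneg fun i _ => hnonneg i,
      Finset.sum_range_sub fun i => V (u i)]
    have h1 := hV (u n) trivial
    have h2 := hV (u 0) trivial
    exact ENNReal.ofReal_le_ofReal (by linarith [h1.2, h2.1])

end Approximant

/-! ### The integral formulas -/

lemma lintegral_upCount_add_le_truncVar {f : ℝ → ℝ} {a b c : ℝ} (hc : 0 < c)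
    (hfin : truncVar f a b c ≠ ⊤) :
    (∫⁻ y, (upCount (Icc a b) f c y : ℝ≥0∞)) +
      ∫⁻ y, (upCount (Icc a b) (fun t => -f t) c y : ℝ≥0∞) ≤ truncVar f a b c := by
  obtain ⟨g, hg, hgv⟩ := exists_approximant hc hfin
  exact (lintegral_upCount_add_le_eVariationOn hg).trans hgv

/-- An upcrossing of `[y, y + c]` is an upcrossing of each `[y', y' + c / 2]` inside it, so an
infinite count at one level would make the integral for `c / 2` infinite. -/
lemma upCount_ne_top_of_lintegral_ne_top {A : Set ℝ} {f : ℝ → ℝ} {c : ℝ} (hc : 0 < c)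
    (h : ∫⁻ y, (upCount A f (c / 2) y : ℝ≥0∞) ≠ ⊤) (y : ℝ) : upCount A f c y ≠ ⊤ := by
  intro htop
  refine h (top_le_iff.1 ?_)
  calc (⊤ : ℝ≥0∞) = ∫⁻ _ in Icc y (y + c / 2), (⊤ : ℝ≥0∞) := by
        rw [setLIntegral_const, Real.volume_Icc, ENNReal.top_mul]
        simpa using hc
    _ ≤ ∫⁻ y' in Icc y (y + c / 2), (upCount A f (c / 2) y' : ℝ≥0∞) := by
        refine setLIntegral_mono (measurable_upCount _ _ _) fun y' hy' => ?_
        have : upCount A f c y ≤ upCount A f (c / 2) y' :=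
          alternationCount_mono subset_rfl (fun t _ (ht : f t < y) => ht.trans_le hy'.1)
            fun t _ (ht : y + c < f t) => by linarith [hy'.2]
        rw [htop, top_le_iff] at this
        simp [this]
    _ ≤ ∫⁻ y, (upCount A f (c / 2) y : ℝ≥0∞) := setLIntegral_le_lintegral _ _

theorem theorem1 (a b : ℝ) (hab : a < b) (f : ℝ → ℝ) (hf : IsRegulatedOn f a b)
    (c : ℝ) (hc : 0 < c) :
    (∀ y : ℝ, segmentUpcrossings f a b c y ≠ ⊤) ∧
    (∀ y : ℝ, segmentDowncrossings f a b c y ≠ ⊤) ∧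
    IsPointwiseLimitOfStepFunctions (fun y => ((segmentUpcrossings f a b c y).toNat : ℝ)) ∧
    IsPointwiseLimitOfStepFunctions (fun y => ((segmentDowncrossings f a b c y).toNat : ℝ)) ∧
    truncVar f a b c ≠ ⊤ ∧
    upTruncVar f a b c = ∫⁻ y : ℝ, (segmentUpcrossings f a b c y : ℝ≥0∞) ∧
    downTruncVar f a b c = ∫⁻ y : ℝ, (segmentDowncrossings f a b c y : ℝ≥0∞) ∧
    truncVar f a b c = ∫⁻ y : ℝ, (segmentCrossings f a b c y : ℝ≥0∞) ∧
    truncVar f a b c =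
      ⨅ (g : ℝ → ℝ) (_ : ∀ t ∈ Icc a b, |f t - g t| ≤ c / 2), eVariationOn g (Icc a b) := by
  have hfin := hf.truncVar_ne_top hc
  have hhalf := lintegral_upCount_add_le_truncVar (half_pos hc) (hf.truncVar_ne_top (half_pos hc))
  have hhalf_top := ne_top_of_le_ne_top (hf.truncVar_ne_top (half_pos hc)) hhalf
  have hu_fin : ∀ y, upCount (Icc a b) f c y ≠ ⊤ :=
    upCount_ne_top_of_lintegral_ne_top hc (ne_top_of_le_ne_top hhalf_top le_self_add)
  have hd_fin : ∀ y, upCount (Icc a b) (fun t => -f t) c y ≠ ⊤ :=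
    upCount_ne_top_of_lintegral_ne_top hc (ne_top_of_le_ne_top hhalf_top le_add_self)
  have hsum := lintegral_upCount_add_le_truncVar hc hfin
  have hU := upTruncVar_le_lintegral_upCount f a b hc
  have hD : downTruncVar f a b c ≤ ∫⁻ y, (upCount (Icc a b) (fun t => -f t) c y : ℝ≥0∞) := by
    rw [downTruncVar_eq_upTruncVar_neg]
    exact upTruncVar_le_lintegral_upCount _ a b hc
  have hUD := truncVar_le_upTruncVar_add_downTruncVar f a b hc
  have hiu := ne_top_of_le_ne_top (ne_top_of_le_ne_top hfin hsum) le_self_add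
  have hid := ne_top_of_le_ne_top (ne_top_of_le_ne_top hfin hsum) le_add_self
  have hTV := le_antisymm (hUD.trans (add_le_add hU hD)) hsum
  have hcross : ∀ y, (segmentCrossings f a b c y : ℝ≥0∞) =
      (segmentDowncrossings f a b c y : ℝ≥0∞) + (upCount (Icc a b) f c y : ℝ≥0∞) := fun y => by
    rw [segmentCrossings, ENat.toENNReal_add, segmentUpcrossings_eq_upCount hab.le]
  refine ⟨fun y => ?_, fun y => ?_, ?_, ?_, hfin, ?_, ?_, ?_, ?_⟩
  · rw [segmentUpcrossings_eq_upCount hab.le]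
    exact hu_fin y
  · rw [segmentDowncrossings_eq_upCount_neg hab.le]
    exact hd_fin _
  · simp only [segmentUpcrossings_eq_upCount hab.le]
    exact isPointwiseLimitOfStepFunctions_upCount hu_fin
  · simp only [segmentDowncrossings_eq_upCount_neg hab.le]
    exact isPointwiseLimitOfStepFunctions_comp_neg_sub
      (isPointwiseLimitOfStepFunctions_upCount hd_fin) c
  -- The chain `∫ u + ∫ d ≤ TV ≤ UTV + DTV ≤ ∫ u + ∫ d` is finite, so equality holds termwise.
  · simp only [segmentUpcrossings_eq_upCount hab.le]
    refine hU.antisymm (le_of_not_gt fun h => ?_)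
    exact absurd (hsum.trans hUD) (not_le.2 (ENNReal.add_lt_add_of_lt_of_le
      (ne_top_of_le_ne_top hid hD) h hD))
  · rw [lintegral_segmentDowncrossings hab.le]
    refine hD.antisymm (le_of_not_gt fun h => ?_)
    exact absurd (hsum.trans hUD) (not_le.2 (ENNReal.add_lt_add_of_le_of_lt
      (ne_top_of_le_ne_top hiu hU) hU h))
  · simp only [hcross]
    rw [lintegral_add_right _ (measurable_upCount _ _ _), lintegral_segmentDowncrossings hab.le,
      hTV, add_comm]
  · refine le_antisymm (le_iInf₂ fun g hg => ?_) ?_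
    · exact hTV.le.trans (lintegral_upCount_add_le_eVariationOn hg)
    · obtain ⟨g, hg, hgv⟩ := exists_approximant hc hfin
      exact (iInf₂_le g hg).trans hgv
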